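/- Work in the class of torsion-free abelian groups with the pure subgroup relation $\leq_p$, where $H\leq_p G$ means that $H$ is a subgroup of $G$ and $nG\cap H=nH$ for every $n\in\mathbb{N}$; a pure embedding is an injective homomorphism whose image is a pure subgroup of the target. Let $\lambda$ be an infinite cardinal and $\alpha<\lambda^+$ a limit ordinal. For torsion-free abelian groups $N\leq_p M$ of cardinality $\lambda$, $M$ is universal over $N$ if for every torsion-free abelian group $N^*$ of cardinality $\lambda$ with $N\leq_p N^*$ there is a pure embedding $f:N^*\to M$ that fixes $N$ pointwise. A torsion-free abelian group $G$ of cardinality $\lambda$ is a $(\lambda,\alpha)$-limit model if $G=\bigcup_{i<\alpha}G_i$ for some family $(G_i)_{i<\alpha}$ of torsion-free abelian groups of cardinality $\lambda$ such that $G_i\leq_p G_j$ for $i\leq j<\alpha$, $G_i=\bigcup_{j<i}G_j$ for every limit ordinal $i<\alpha$, and $G_{i+1}$ is universal over $G_i$ for every $i<\alpha$. An abelian group $G$ is algebraically compact if every countable system of linear equations over $G$ (with integer coefficients, constants in $G$, and finitely many of the countably many unknowns in each equation) is solvable in $G$ if and only if each of its finite subsystems is solvable in $G$. If $G$ is a $(\lambda,\alpha)$-limit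 model (with $\alpha$ of any cofinality) and $G$ is algebraically compact, then \[ G\;\cong\;\Big(\bigoplus_{\lambda}\mathbb{Q}\Big)\oplus\prod_{p\text{ prime}}\overline{\Big(\bigoplus_{\lambda}\mathbb{Z}_{(p)}\Big)}, \] where $\mathbb{Z}_{(p)}=\{n/m\in\mathbb{Q}:\gcd(m,p)=1\}$ and the overline denotes completion in the $p$-adic topology (the topology on $A$ with the subgroups $p^kA$ as a basis of neighbourhoods of $0$). -/

import Mathlib

universe u v

/-- `H` is a pure subgroup of `G`: `nG ∩ H = nH` for every natural number `n`. -/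
def IsPureSubgroup {G : Type u} [AddCommGroup G] (H : AddSubgroup G) : Prop :=
  ∀ n : ℕ, {x : G | (∃ g : G, n • g = x) ∧ x ∈ H} = {x : G | ∃ h ∈ H, n • h = x}

/-- Membership in the class of torsion-free abelian groups of cardinality `lam`. -/
structure IsTorsionFreeOfCard (lam : Cardinal.{u}) (H : Type u) [AddCommGroup H] : Prop where
  torsionFree : IsAddTorsionFree H
  card_eq : Cardinal.mk H = lam

/-- Embeddings of the class: injective homomorphisms whose range is a pure subgroup. -/
structure IsPureEmbedding {H G : Type u} [AddCommGroup H] [AddCommGroup G] (f : H →+ G) :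
    Prop where
  injective : Function.Injective f
  pure_range : IsPureSubgroup f.range

/-- For subgroups `A`, `B` of `G`: `A` is contained in `B` and is a pure subgroup of `B`. -/
def PureLE {G : Type u} [AddCommGroup G] (A B : AddSubgroup G) : Prop :=
  A ≤ B ∧ IsPureSubgroup (A.addSubgroupOf B)

/-- `B` is universal over its pure subgroup `A`, both torsion-free of cardinality `lam`: every
torsion-free group `H` of cardinality `lam` containing `A` as a pure subgroup (via `g`) admits a
pure embedding `f` into `B` that fixes `A` pointwise. -/
def IsUniversalOver (lam : Cardinal.{u}) {G : Type u} [AddCommGroup G] (B A : AddSubgroup G) :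
    Prop :=
  PureLE A B ∧ IsTorsionFreeOfCard lam A ∧ IsTorsionFreeOfCard lam B ∧
    ∀ (H : Type u) [AddCommGroup H], IsTorsionFreeOfCard lam H →
      ∀ g : A →+ H, IsPureEmbedding g →
        ∃ f : H →+ B, IsPureEmbedding f ∧ ∀ a : A, (f (g a) : G) = (a : G)

/-- `G` is a `(lam, α)`-limit model over its subgroup `N`, in the class of torsion-free abelian
groups with the pure subgroup relation. Only the members `M i` with `i < α` of the family matter. -/
def IsLimitModelOver (lam : Cardinal.{u}) (α : Ordinal.{u}) (G : Type u) [AddCommGroup G]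
    (N : AddSubgroup G) : Prop :=
  ∃ M : Ordinal.{u} → AddSubgroup G,
    (∀ i < α, IsTorsionFreeOfCard lam (M i)) ∧
    (∀ i j : Ordinal.{u}, i ≤ j → j < α → PureLE (M i) (M j)) ∧
    (∀ i < α, Order.IsSuccLimit i → (M i : Set G) = ⋃ j, ⋃ _ : j < i, (M j : Set G)) ∧
    M 0 = N ∧
    (∀ i < α, IsUniversalOver lam (M (i + 1)) (M i)) ∧
    (Set.univ : Set G) = ⋃ i, ⋃ _ : i < α, (M i : Set G)

/-- `G` is a `(lam, α)`-limit model in the class of torsion-free abelian groups with the pure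
subgroup relation. -/
def IsLimitModel (lam : Cardinal.{u}) (α : Ordinal.{u}) (G : Type u) [AddCommGroup G] : Prop :=
  IsTorsionFreeOfCard lam G ∧
    ∃ N : AddSubgroup G, IsTorsionFreeOfCard lam N ∧ IsLimitModelOver lam α G N

/-- `G` is algebraically compact: a system `∑ k, f i k • x k = a i` (`i < ω`) of linear equations
over `G`, each involving finitely many of the unknowns, is finitely solvable in `G` if and only if
it is solvable in `G`. -/
def IsAlgebraicallyCompact (G : Type u) [AddCommGroup G] : Prop :=
  ∀ (f : ℕ → ℕ →₀ ℤ) (a : ℕ → G),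
    (∀ S : Finset ℕ, ∃ x : ℕ → G, ∀ i ∈ S, ((f i).sum fun k c => c • x k) = a i) ↔
      ∃ x : ℕ → G, ∀ i, ((f i).sum fun k c => c • x k) = a i

/-- The group `ℤ_(p)` of rationals `n / m` with `m` coprime to the prime `p`. -/
def localizedIntegers (p : Nat.Primes) : AddSubgroup ℚ where
  carrier := {q | ∃ n m : ℤ, IsCoprime m (p : ℤ) ∧ q = (n : ℚ) / (m : ℚ)}
  zero_mem' := ⟨0, 1, isCoprime_one_left, by simp⟩
  neg_mem' := by
    rintro _ ⟨n, m, h, rfl⟩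
    exact ⟨-n, m, h, by push_cast; ring⟩
  add_mem' := by
    rintro _ _ ⟨n, m, h, rfl⟩ ⟨n', m', h', rfl⟩
    have aux : ∀ k : ℤ, IsCoprime k (p : ℤ) → (k : ℚ) ≠ 0 := by
      rintro k hk h0
      have hk0 : k = 0 := by exact_mod_cast h0
      subst hk0
      rw [isCoprime_zero_left] at hk
      exact (Nat.prime_iff_prime_int.mp p.2).not_isUnit hk
    refine ⟨n * m' + m * n', m * m', h.mul_left h', ?_⟩
    rw [div_add_div _ _ (aux m h) (aux m' h')]
    push_cast
    rfl

/-- The completion, in the `p`-adic topology, of an abelian group `A`. -/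
abbrev PAdicCompletion (p : Nat.Primes) (A : Type v) [AddCommGroup A] : Type v :=
  AdicCompletion (Ideal.span {((p : ℕ) : ℤ)}) A

/-! Torsion-free plus algebraically compact already gives `G ≅ D × ∏ p, Ĝ_p`, with `D` the divisible
part. `D` splits off because it is injective, and it is the kernel of the diagonal map to the
completions. That map is onto because a point of the product is a countable system of congruences
modulo prime powers, finitely solvable by the Chinese remainder theorem.

It remains to find two invariants: the rational rank of `D`, and the dimension of `G/pG`, which
determines `Ĝ_p`. Both are at most `|G| = lam`. For the lower bounds, universality of the second
member of the chain over the first, tested on the first member times `X`, embeds every torsion-free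
`X` with `|X| ≤ lam` purely in `G`; take `X` free over `ℚ`, then over `ℤ`, of rank `lam`. Only the
start of the chain is used for the embedding, so the cofinality of `α` plays no role. -/

section Divisible

/-! ### Divisible groups as rational vector spaces -/

/-- A torsion-free divisible abelian group is a rational vector space. -/
noncomputable abbrev DivisibleBy.ratModule (A : Type*) [AddCommGroup A] [IsAddTorsionFree A]
    [DivisibleBy A ℤ] : Module ℚ A :=
  letI : SMul ℚ A := ⟨fun q a => q.num • DivisibleBy.div a (q.den : ℤ)⟩
  -- This equation characterizes `q • a`, so each nontrivial axiom can be checked after clearing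
  -- denominators.
  have den_smul (q : ℚ) (a : A) : (q.den : ℤ) • (q • a) = q.num • a := by
    change (q.den : ℤ) • (q.num • DivisibleBy.div a (q.den : ℤ)) = _
    rw [smul_comm, DivisibleBy.div_cancel a (by exact_mod_cast q.den_ne_zero)]
  have den_ne (q : ℚ) : (q.den : ℤ) ≠ 0 := by exact_mod_cast q.den_ne_zero
  have cancel {n : ℤ} (hn : n ≠ 0) {a b : A} (h : n • a = n • b) : a = b :=
    smul_right_injective A hn h
  { one_smul := fun a => by simpa using den_smul 1 a
    mul_smul := fun q r a => by
      apply cancel (mul_ne_zero (den_ne (q * r)) (mul_ne_zero (den_ne q) (den_ne r)))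
      have h := Rat.mul_num_den' q r
      calc _ = ((q.den : ℤ) * r.den) • (((q * r).den : ℤ) • ((q * r) • a)) := by
            rw [smul_smul, mul_comm]
        _ = ((q * r).num * q.den * r.den) • a := by
            rw [den_smul, smul_smul]; congr 1; ring
        _ = ((q * r).den * q.num : ℤ) • (r.num • a) := by
            rw [smul_smul, h]; congr 1; ring
        _ = ((q * r).den * r.den : ℤ) • ((q.den : ℤ) • (q • r • a)) := by
            rw [← den_smul r, den_smul q, smul_smul, smul_smul]; congr 1; ring
        _ = _ := by rw [smul_smul]; congr 1; ring
    smul_zero := fun q => cancel (den_ne q) (by rw [den_smul]; simp)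
    zero_smul := fun a => by simpa using den_smul 0 a
    smul_add := fun q a b => cancel (den_ne q) (by rw [smul_add, den_smul, den_smul, den_smul,
      smul_add])
    add_smul := fun q r a => by
      apply cancel (mul_ne_zero (den_ne (q + r)) (mul_ne_zero (den_ne q) (den_ne r)))
      have h := Rat.add_num_den' q r
      calc _ = ((q.den : ℤ) * r.den) • (((q + r).den : ℤ) • ((q + r) • a)) := by
            rw [smul_smul, mul_comm]
        _ = ((q + r).num * q.den * r.den) • a := by
            rw [den_smul, smul_smul]; congr 1; ring
        _ = ((q + r).den * r.den : ℤ) • (q.num • a) + ((q + r).den * q.den : ℤ) • (r.num • a) := by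
            rw [smul_smul, smul_smul, ← add_smul, h]; congr 1; ring
        _ = _ := by
            rw [← den_smul, ← den_smul, smul_add, smul_smul, smul_smul]
            congr 2 <;> ring }

/-- The elements of an abelian group that are divisible by every nonzero integer. -/
def divisiblePart (G : Type*) [AddCommGroup G] : AddSubgroup G where
  carrier := {x | ∀ n : ℤ, n ≠ 0 → ∃ y, n • y = x}
  zero_mem' n _ := ⟨0, smul_zero n⟩
  neg_mem' h n hn := let ⟨y, hy⟩ := h n hn; ⟨-y, by rw [smul_neg, hy]⟩
  add_mem' h h' n hn :=
    let ⟨y, hy⟩ := h n hn; let ⟨y', hy'⟩ := h' n hn; ⟨y + y', by rw [smul_add, hy, hy']⟩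

/-- Quotients are unique in a torsion-free group: dividing `x` by `n * m` also divides `y` by `m`.
-/
theorem exists_mem_divisiblePart_smul_eq {G : Type*} [AddCommGroup G] [IsAddTorsionFree G]
    {x : G} (hx : x ∈ divisiblePart G) {n : ℤ} (hn : n ≠ 0) :
    ∃ y ∈ divisiblePart G, n • y = x := by
  obtain ⟨y, rfl⟩ := hx n hn
  refine ⟨y, fun m hm => ?_, rfl⟩
  obtain ⟨z, hz⟩ := hx (n * m) (mul_ne_zero hn hm)
  exact ⟨z, smul_right_injective G hn (by simpa [mul_smul] using hz)⟩

noncomputable instance (G : Type*) [AddCommGroup G] [IsAddTorsionFree G] :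
    DivisibleBy (divisiblePart G) ℤ :=
  divisibleByOfSMulRightSurj _ _ fun {n} hn x => by
    obtain ⟨y, hy, h⟩ := exists_mem_divisiblePart_smul_eq x.2 hn
    exact ⟨⟨y, hy⟩, Subtype.ext h⟩

instance (G : Type*) [AddCommGroup G] [IsAddTorsionFree G] :
    IsAddTorsionFree (divisiblePart G) :=
  Function.Injective.isAddTorsionFree (divisiblePart G).subtype Subtype.val_injective

end Divisible

/-! ### Comparing `p`-adic completions -/

section Completion

open AdicCompletion

variable {p : Nat.Primes} {A : Type u} {B : Type v} [AddCommGroup A] [AddCommGroup B]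

theorem mem_span_pow_smul_top {r : ℤ} {n : ℕ} {x : A} :
    x ∈ (Ideal.span {r} ^ n • ⊤ : Submodule ℤ A) ↔ ∃ y : A, r ^ n • y = x := by
  rw [Ideal.span_singleton_pow, Submodule.ideal_span_singleton_smul,
    Submodule.mem_smul_pointwise_iff_exists]
  simp

/-- A homomorphism that induces isomorphisms modulo all powers of `p` induces an isomorphism
of `p`-adic completions. -/
theorem bijective_map_of_forall_pow (f : A →+ B)
    (hinj : ∀ (n : ℕ) (a : A) (b : B), ((p : ℕ) : ℤ) ^ n • b = f a →
      ∃ a', ((p : ℕ) : ℤ) ^ n • a' = a)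
    (hsurj : ∀ (n : ℕ) (b : B), ∃ a b', b = f a + ((p : ℕ) : ℤ) ^ n • b') :
    Function.Bijective (AdicCompletion.map (Ideal.span {((p : ℕ) : ℤ)}) f.toIntLinearMap) := by
  set I := Ideal.span {((p : ℕ) : ℤ)}
  have key : ∀ n, Function.Bijective (f.toIntLinearMap.reduceModIdeal (I ^ n)) := by
    refine fun n => ⟨?_, fun y => ?_⟩
    · rw [injective_iff_map_eq_zero]
      intro x
      obtain ⟨a, rfl⟩ := Submodule.Quotient.mk_surjective _ x
      rw [LinearMap.reduceModIdeal_apply, Submodule.Quotient.mk_eq_zero,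
        Submodule.Quotient.mk_eq_zero, mem_span_pow_smul_top, mem_span_pow_smul_top]
      rintro ⟨b, hb⟩
      exact hinj n a b hb
    · obtain ⟨b, rfl⟩ := Submodule.Quotient.mk_surjective _ y
      obtain ⟨a, b', h⟩ := hsurj n b
      refine ⟨Submodule.Quotient.mk a, ?_⟩
      rw [LinearMap.reduceModIdeal_apply, eq_comm, Submodule.Quotient.eq, mem_span_pow_smul_top]
      exact ⟨b', by rw [h]; simp⟩
  refine ⟨fun x y h => AdicCompletion.ext fun n => (key n).1 ?_, fun y => ?_⟩
  · have := congrArg (fun z => z.val n) h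
    simpa only [AdicCompletion.map_val_apply] using this
  · choose g hg using fun n => (key n).2 (y.val n)
    -- The levelwise preimages form a compatible family because they are unique.
    refine ⟨⟨g, fun {m n} hmn => (key m).injective ?_⟩, AdicCompletion.ext fun n => ?_⟩
    · have := LinearMap.congr_fun
        (AdicCompletion.transitionMap_comp_reduceModIdeal I f.toIntLinearMap hmn) (g n)
      rw [LinearMap.comp_apply, LinearMap.comp_apply] at this
      rw [hg]
      refine this.symm.trans ?_
      exact (congrArg _ (hg n)).trans (y.2 hmn)
    · exact (AdicCompletion.map_val_apply I _ _).trans (hg n)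

/-- A homomorphism of torsion-free groups that induces an isomorphism modulo `p` induces an
isomorphism of `p`-adic completions. -/
theorem nonempty_pAdicCompletion_equiv [IsAddTorsionFree B] (f : A →+ B)
    (hinj : ∀ (a : A) (b : B), ((p : ℕ) : ℤ) • b = f a → ∃ a', ((p : ℕ) : ℤ) • a' = a)
    (hsurj : ∀ b : B, ∃ a b', b = f a + ((p : ℕ) : ℤ) • b') :
    Nonempty (PAdicCompletion p A ≃+ PAdicCompletion p B) := by
  have hp : ((p : ℕ) : ℤ) ≠ 0 := by exact_mod_cast p.2.ne_zero
  refine ⟨(LinearEquiv.ofBijective _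
    (bijective_map_of_forall_pow (p := p) f (fun n => ?_) (fun n => ?_))).toAddEquiv⟩
  · induction n with
    | zero => exact fun a _ _ => ⟨a, by simp⟩
    | succ n ih =>
      intro a b h
      -- Peel off one factor `p` from `a`, cancel it in `B`, and descend to exponent `n`.
      obtain ⟨a₁, rfl⟩ := hinj a (((p : ℕ) : ℤ) ^ n • b) (by rw [← h, smul_smul, pow_succ'])
      obtain ⟨a₂, rfl⟩ := ih a₁ b (smul_right_injective B hp (by
        simpa [pow_succ', mul_smul] using h))
      exact ⟨a₂, by rw [smul_smul, pow_succ']⟩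
  · induction n with
    | zero => exact fun b => ⟨0, b, by simp⟩
    | succ n ih =>
      intro b
      -- Successive approximation: the error `p ^ n • b₁` is improved by approximating `b₁` modulo
      -- `p`.
      obtain ⟨a₁, b₁, rfl⟩ := ih b
      obtain ⟨a₂, b₂, rfl⟩ := hsurj b₁
      exact ⟨a₁ + ((p : ℕ) : ℤ) ^ n • a₂, b₂, by
        rw [map_add, map_zsmul, smul_add, smul_smul, ← pow_succ, add_assoc]⟩

end Completion

/-! ### Structure of torsion-free algebraically compact groups -/

section Structure

variable {G : Type u} [AddCommGroup G]

/-- By Bézout, divisibility by coprime `a` and `b` gives divisibility by `a * b`. -/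
theorem mem_divisiblePart_of_forall_prime_pow {x : G}
    (h : ∀ (p : Nat.Primes) (n : ℕ), ∃ y, ((p : ℕ) : ℤ) ^ n • y = x) : x ∈ divisiblePart G := by
  have key : ∀ n : ℕ, n ≠ 0 → ∃ y, (n : ℤ) • y = x := by
    intro n
    induction n using Nat.recOnPosPrimePosCoprime with
    | zero => exact fun h => absurd rfl h
    | one => exact fun _ => ⟨x, by simp⟩
    | prime_pow p n hp _ => exact fun _ => by simpa using h ⟨p, hp⟩ n
    | coprime a b ha hb hab iha ihb =>
      intro _
      obtain ⟨y, hy⟩ := iha (by omega)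
      obtain ⟨z, hz⟩ := ihb (by omega)
      obtain ⟨u, v, huv⟩ := Nat.isCoprime_iff_coprime.2 hab
      refine ⟨u • z + v • y, ?_⟩
      calc _ = (u * a) • ((b : ℤ) • z) + (v * b) • ((a : ℤ) • y) := by
            push_cast; module
        _ = x := by rw [hy, hz, ← add_smul, huv, one_smul]
  intro n hn
  obtain ⟨y, hy⟩ := key n.natAbs (by omega)
  obtain h | h := Int.natAbs_eq n
  · exact ⟨y, by rw [h, hy]⟩
  · exact ⟨-y, by rw [h, smul_neg, neg_smul, neg_neg, hy]⟩

/-- The Chinese remainder theorem for finitely many congruences modulo prime powers. -/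
theorem exists_forall_sub_eq_prime_pow_smul (P : Finset Nat.Primes) (K : ℕ)
    (a : Nat.Primes → G) : ∃ x, ∀ p ∈ P, ∃ y, x - a p = ((p : ℕ) : ℤ) ^ K • y := by
  classical
  induction P using Finset.induction_on with
  | empty => exact ⟨0, by simp⟩
  | insert q P hq ih =>
    obtain ⟨x, hx⟩ := ih
    have hcop : IsCoprime (∏ p ∈ P, ((p : ℕ) : ℤ) ^ K) (((q : ℕ) : ℤ) ^ K) := by
      refine IsCoprime.prod_left fun p hp => IsCoprime.pow ?_
      refine Nat.isCoprime_iff_coprime.2 ((Nat.coprime_primes p.2 q.2).2 fun h => hq ?_)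
      rwa [← Subtype.ext h]
    obtain ⟨u, v, huv⟩ := hcop
    set N := ∏ p ∈ P, ((p : ℕ) : ℤ) ^ K with hN
    -- `u * N` is `0` modulo the old prime powers and `1` modulo `q ^ K`.
    refine ⟨x + (u * N) • (a q - x), fun p hp => ?_⟩
    obtain rfl | hp := Finset.mem_insert.1 hp
    · refine ⟨v • (x - a p), ?_⟩
      have : u * N = 1 - v * ((p : ℕ) : ℤ) ^ K := by rw [← huv]; ring
      rw [this]; module
    · obtain ⟨y, hy⟩ := hx p hp
      obtain ⟨c, hc⟩ := Finset.dvd_prod_of_mem (fun p : Nat.Primes => ((p : ℕ) : ℤ) ^ K) hp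
      refine ⟨y + (u * c) • (a q - x), ?_⟩
      rw [add_sub_right_comm, hy, hN, hc]
      module

/-- Countably many congruences over an algebraically compact group are solvable if any finitely
many of them are. -/
theorem IsAlgebraicallyCompact.exists_forall_sub_eq_smul (hac : IsAlgebraicallyCompact G)
    {ι : Type*} [Countable ι] (m : ι → ℤ) (a : ι → G)
    (h : ∀ S : Finset ι, ∃ x, ∀ i ∈ S, ∃ y, x - a i = m i • y) :
    ∃ x, ∀ i, ∃ y, x - a i = m i • y := by
  classical
  cases isEmpty_or_nonempty ι
  · exact ⟨0, fun i => isEmptyElim i⟩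
  obtain ⟨e, he⟩ := exists_surjective_nat ι
  -- Unknown `0` is the common solution; unknown `i + 1` is the quotient witnessing the `i`-th
  -- congruence.
  have heval (x : ℕ → G) (i : ℕ) :
      ((Finsupp.single 0 1 - Finsupp.single (i + 1) (m (e i)) : ℕ →₀ ℤ).sum fun k c => c • x k) =
        x 0 - m (e i) • x (i + 1) := by
    have hsingle (k : ℕ) (c : ℤ) : (Finsupp.single k c).sum (fun k c => c • x k) = c • x k :=
      Finsupp.sum_single_index (zero_smul _ _)
    rw [Finsupp.sum_sub_index fun _ _ _ => sub_smul _ _ _, hsingle, hsingle, one_smul]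
  obtain ⟨x, hx⟩ := (hac (fun i => Finsupp.single 0 1 - Finsupp.single (i + 1) (m (e i)))
    fun i => a (e i)).1 fun S => by
      obtain ⟨x, hx⟩ := h (S.image e)
      have hx' : ∀ i, ∃ y, i ∈ S → x - a (e i) = m (e i) • y := fun i => by
        by_cases hi : i ∈ S
        · obtain ⟨y, hy⟩ := hx (e i) (Finset.mem_image_of_mem e hi)
          exact ⟨y, fun _ => hy⟩
        · exact ⟨0, fun h => absurd h hi⟩
      choose y hy using hx'
      refine ⟨fun k => k.casesOn x y, fun i hi => ?_⟩
      rw [heval]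
      change x - m (e i) • y i = _
      rw [← hy i hi, sub_sub_cancel]
  refine ⟨x 0, fun i => ?_⟩
  obtain ⟨j, rfl⟩ := he i
  exact ⟨x (j + 1), by rw [← hx j, heval, sub_sub_cancel]⟩

/-- The diagonal map of a group to the product of its `p`-adic completions. -/
noncomputable def toPiPAdicCompletion (G : Type u) [AddCommGroup G] :
    G →+ ∀ p : Nat.Primes, PAdicCompletion p G :=
  AddMonoidHom.pi fun p => (AdicCompletion.of (Ideal.span {((p : ℕ) : ℤ)}) G).toAddMonoidHom

theorem toPiPAdicCompletion_apply_val (x : G) (p : Nat.Primes) (n : ℕ) :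
    (toPiPAdicCompletion G x p).val n = Submodule.Quotient.mk x := rfl

/-- The kernel is the intersection of all `p ^ n G`, over all primes and exponents. -/
theorem toPiPAdicCompletion_eq_zero_iff {x : G} :
    toPiPAdicCompletion G x = 0 ↔ x ∈ divisiblePart G := by
  refine ⟨fun h => mem_divisiblePart_of_forall_prime_pow fun p n => ?_, fun h => ?_⟩
  · rw [← mem_span_pow_smul_top, ← Submodule.Quotient.mk_eq_zero,
      ← toPiPAdicCompletion_apply_val, h]
    rfl
  · refine funext fun p => AdicCompletion.ext fun n => ?_
    rw [toPiPAdicCompletion_apply_val]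
    exact (Submodule.Quotient.mk_eq_zero _).2 <| mem_span_pow_smul_top.2 <|
      h _ (pow_ne_zero _ (by exact_mod_cast p.2.ne_zero))

theorem IsAlgebraicallyCompact.toPiPAdicCompletion_surjective (hac : IsAlgebraicallyCompact G) :
    Function.Surjective (toPiPAdicCompletion G) := by
  classical
  intro z
  choose a ha using fun (p : Nat.Primes) (n : ℕ) =>
    Submodule.Quotient.mk_surjective _ ((z p).val n)
  have hcomp (p : Nat.Primes) {m n : ℕ} (hmn : m ≤ n) :
      ∃ y, a p n - a p m = ((p : ℕ) : ℤ) ^ m • y := by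
    have h := (z p).2 hmn
    rw [← ha p n, ← ha p m] at h
    obtain ⟨y, hy⟩ := mem_span_pow_smul_top.1 ((Submodule.Quotient.eq _).1 h)
    exact ⟨y, hy.symm⟩
  obtain ⟨x, hx⟩ := hac.exists_forall_sub_eq_smul
    (fun i : Nat.Primes × ℕ => ((i.1 : ℕ) : ℤ) ^ i.2) (fun i => a i.1 i.2) fun S => by
      -- Work at the largest exponent in `S`; compatibility of `z` then yields the congruences at
      -- smaller exponents.
      obtain ⟨x, hx⟩ := exists_forall_sub_eq_prime_pow_smul (S.image Prod.fst)
        (S.sup Prod.snd) fun p => a p (S.sup Prod.snd)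
      refine ⟨x, fun i hi => ?_⟩
      have hle : i.2 ≤ S.sup Prod.snd := Finset.le_sup (f := Prod.snd) hi
      obtain ⟨y, hy⟩ := hx i.1 (Finset.mem_image_of_mem _ hi)
      obtain ⟨y', hy'⟩ := hcomp i.1 hle
      obtain ⟨c, hc⟩ := pow_dvd_pow ((i.1 : ℕ) : ℤ) hle
      refine ⟨c • y + y', ?_⟩
      rw [smul_add, smul_smul, ← hc, ← hy, ← hy', sub_add_sub_cancel]
  refine ⟨x, funext fun p => AdicCompletion.ext fun n => ?_⟩
  obtain ⟨y, hy⟩ := hx (p, n)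
  rw [toPiPAdicCompletion_apply_val, ← ha p n]
  exact (Submodule.Quotient.eq _).2 (mem_span_pow_smul_top.2 ⟨y, hy.symm⟩)

/-- A torsion-free algebraically compact group is the direct sum of its divisible part and of its
`p`-adic completions. -/
theorem IsAlgebraicallyCompact.nonempty_equiv [IsAddTorsionFree G]
    (hac : IsAlgebraicallyCompact G) :
    Nonempty (G ≃+ (divisiblePart G × ∀ p : Nat.Primes, PAdicCompletion p G)) := by
  -- Divisible groups are injective, so the identity of the divisible part extends to a retraction.
  obtain ⟨r, hr⟩ := Module.Baer.extension_property_addMonoidHom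
    (Module.Baer.of_divisible (divisiblePart G)) (divisiblePart G).subtype
    Subtype.val_injective (AddMonoidHom.id _)
  have hr' (d : divisiblePart G) : r d = d := DFunLike.congr_fun hr d
  refine ⟨AddEquiv.ofBijective (r.prod (toPiPAdicCompletion G)) ⟨?_, fun ⟨d, z⟩ => ?_⟩⟩
  · rw [injective_iff_map_eq_zero]
    intro x hx
    obtain ⟨h₁, h₂⟩ := Prod.ext_iff.1 hx
    have := hr' ⟨x, toPiPAdicCompletion_eq_zero_iff.1 h₂⟩
    exact congrArg Subtype.val (this.symm.trans h₁)
  · obtain ⟨x, rfl⟩ := hac.toPiPAdicCompletion_surjective z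
    -- A divisible correction fixes the first coordinate and is invisible to the completions.
    refine ⟨x + (d - r x : divisiblePart G), Prod.ext ?_ ?_⟩
    · change r _ = d
      rw [map_add, hr', add_sub_cancel]
    · change toPiPAdicCompletion G _ = _
      rw [map_add, toPiPAdicCompletion_eq_zero_iff.2 (d - r x).2, add_zero]

end Structure

/-! ### Pure embeddings into limit models -/

section LimitModel

variable {lam : Cardinal.{u}}

theorem aleph0_le_of_isSuccLimit_lt {α : Ordinal.{u}} (hα : Order.IsSuccLimit α)
    (hαlam : α < (Order.succ lam).ord) : Cardinal.aleph0 ≤ lam := by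
  by_contra! h
  have h1 : Order.succ lam < Cardinal.aleph0 := Cardinal.isSuccLimit_aleph0.succ_lt h
  have h2 : (Order.succ lam).ord < Ordinal.omega0 := by
    rw [← Cardinal.ord_aleph0]; exact Cardinal.ord_lt_ord.2 h1
  exact absurd (hαlam.trans h2) (not_lt.2 (Ordinal.omega0_le_of_isSuccLimit hα))

/-- Every torsion-free group of cardinality at most `lam` embeds purely into a
`(lam, α)`-limit model. -/
theorem IsLimitModel.exists_pure_embedding {α : Ordinal.{u}} (hα : Order.IsSuccLimit α)
    (hlam : Cardinal.aleph0 ≤ lam) {G : Type u} [AddCommGroup G] (hG : IsLimitModel lam α G)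
    {X : Type u} [AddCommGroup X] [IsAddTorsionFree X] (hX : Cardinal.mk X ≤ lam) :
    ∃ f : X →+ G, Function.Injective f ∧ ∀ (n : ℕ) g x, n • g = f x → ∃ x', n • x' = x := by
  obtain ⟨-, N, -, M, hM, hpure, -, -, huniv, hcover⟩ := hG
  have h0 : 0 < α := hα.bot_lt
  have h1 : (1 : Ordinal) < α := by simpa using hα.succ_lt h0
  obtain ⟨-, -, -, hu⟩ := huniv 0 h0
  rw [zero_add] at hu
  have := (hM 0 h0).torsionFree
  have hinl : IsPureEmbedding (AddMonoidHom.inl (M 0) X) := by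
    refine ⟨fun x y h => (Prod.ext_iff.1 h).1, fun n => Set.ext fun x => ⟨?_, ?_⟩⟩
    · rintro ⟨⟨g, rfl⟩, y, hy⟩
      exact ⟨(g.1, 0), ⟨g.1, rfl⟩, Prod.ext rfl <| by simpa using (Prod.ext_iff.1 hy).2⟩
    · rintro ⟨h, hh, rfl⟩
      exact ⟨⟨h, rfl⟩, nsmul_mem hh n⟩
  -- `X` may be smaller than `lam`; the factor `M 0` brings the cardinality up to exactly `lam`.
  obtain ⟨f, hf, -⟩ := hu (M 0 × X) ⟨inferInstance, by
    rw [Cardinal.mk_prod, Cardinal.lift_id, Cardinal.lift_id, (hM 0 h0).card_eq,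
      Cardinal.mul_eq_left hlam hX (Cardinal.mk_ne_zero X)]⟩ _ hinl
  refine ⟨(M 1).subtype.comp (f.comp (AddMonoidHom.inr _ _)), fun x y h =>
    (Prod.ext_iff.1 (hf.injective (Subtype.ext h))).2, fun n g x hgx => ?_⟩
  -- A quotient `g` found in `G` lives in a stage containing `M 1`; purity moves divisibility down
  -- to `M 1`, then to the range of `f`, and projection to `X` finishes.
  obtain ⟨j, hj, hgj⟩ : ∃ j < α, g ∈ M j := by
    have := hcover.subset (Set.mem_univ g)
    simpa using this
  have hk : max j 1 < α := max_lt hj h1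
  have hgk : g ∈ M (max j 1) := (hpure j _ (le_max_left _ _) hk).1 hgj
  obtain ⟨hle, hp⟩ := hpure 1 _ (le_max_right j 1) hk
  obtain ⟨m, hm, hmx⟩ := (hp n).subset
    (show (⟨f (0, x), hle (f (0, x)).2⟩ : M (max j 1)) ∈ _ from
      ⟨⟨⟨g, hgk⟩, Subtype.ext hgx⟩, (f (0, x)).2⟩)
  obtain ⟨_, ⟨h, rfl⟩, hh⟩ := (hf.pure_range n).subset
    (show f (0, x) ∈ _ from ⟨⟨⟨m, hm⟩, Subtype.ext (congrArg Subtype.val hmx :)⟩, _, rfl⟩)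
  rw [← map_nsmul] at hh
  exact ⟨h.2, (Prod.ext_iff.1 (hf.injective hh)).2⟩

end LimitModel

/-! ### Rank of the divisible part and dimensions modulo `p` -/

section Invariants

variable {lam : Cardinal.{u}} {G : Type u} [AddCommGroup G] [IsAddTorsionFree G]

theorem nonempty_divisiblePart_equiv (hcard : Cardinal.mk G ≤ lam) (f : (lam.out →₀ ℚ) →+ G)
    (hf : Function.Injective f) : Nonempty (divisiblePart G ≃+ (lam.out →₀ ℚ)) := by
  let : Module ℚ (divisiblePart G) := DivisibleBy.ratModule _
  have hmem (c) : f c ∈ divisiblePart G := fun n hn =>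
    ⟨f ((n : ℚ)⁻¹ • c), by
      rw [← map_zsmul, ← Int.cast_smul_eq_zsmul ℚ, smul_inv_smul₀ (by exact_mod_cast hn)]⟩
  have hle : lam ≤ Module.rank ℚ (divisiblePart G) := by
    have := LinearMap.rank_le_of_injective (f.codRestrict _ hmem).toRatLinearMap
      fun x y h => hf (congrArg Subtype.val h)
    simpa using this
  have hge : Module.rank ℚ (divisiblePart G) ≤ lam :=
    (rank_le_card _ _).trans ((Cardinal.mk_le_of_injective Subtype.val_injective).trans hcard)
  have hrank : Module.rank ℚ (divisiblePart G) = Module.rank ℚ (lam.out →₀ ℚ) := by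
    simpa using le_antisymm hge hle
  exact (nonempty_linearEquiv_of_rank_eq hrank).map LinearEquiv.toAddEquiv

theorem ratCast_ne_zero_of_isCoprime_prime {p : Nat.Primes} {m : ℤ}
    (hm : IsCoprime m (p : ℤ)) : (m : ℚ) ≠ 0 := by
  intro h0
  obtain rfl : m = 0 := by exact_mod_cast h0
  exact (Nat.prime_iff_prime_int.mp p.2).not_isUnit (isCoprime_zero_left.1 hm)

/-- From `u * m + v * p = 1` one gets `n / m = n * u + p * (n * v / m)`. With the next lemma, this
makes `ℤ → ℤ_(p)` an isomorphism modulo `p`. -/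
theorem exists_eq_intCast_add_smul {p : Nat.Primes} (q : localizedIntegers p) :
    ∃ (k : ℤ) (r : localizedIntegers p), (q : ℚ) = k + ((p : ℕ) : ℤ) • (r : ℚ) := by
  obtain ⟨_, n, m, hm, rfl⟩ := q
  have hm0 := ratCast_ne_zero_of_isCoprime_prime hm
  have ⟨u, v, huv⟩ := hm
  refine ⟨n * u, ⟨n * v / m, n * v, m, hm, by push_cast; rfl⟩, ?_⟩
  have huv' : (u * m + v * p : ℚ) = 1 := by exact_mod_cast huv
  rw [zsmul_eq_mul]
  push_cast
  field_simp
  linear_combination (-(n : ℚ)) * huv'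

theorem dvd_of_smul_localizedIntegers_eq {p : Nat.Primes} (k : ℤ) (r : localizedIntegers p)
    (h : ((p : ℕ) : ℤ) • (r : ℚ) = k) : ((p : ℕ) : ℤ) ∣ k := by
  obtain ⟨_, n, m, hm, rfl⟩ := r
  have hm0 := ratCast_ne_zero_of_isCoprime_prime hm
  refine hm.symm.dvd_of_dvd_mul_right ⟨n, ?_⟩
  rw [zsmul_eq_mul] at h
  field_simp at h
  rw [mul_comm]
  exact_mod_cast h.symm

theorem exists_smul_eq_of_forall_dvd {ι : Type*} {n : ℤ} {c : ι →₀ ℤ} (h : ∀ i, n ∣ c i) :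
    ∃ c' : ι →₀ ℤ, n • c' = c :=
  ⟨c.mapRange (· / n) (Int.zero_ediv n), Finsupp.ext fun i => Int.mul_ediv_cancel' (h i)⟩

theorem nonempty_pAdicCompletion_int_equiv (p : Nat.Primes) (ι : Type v) :
    Nonempty (PAdicCompletion p (ι →₀ ℤ) ≃+ PAdicCompletion p (ι →₀ localizedIntegers p)) := by
  let e : ℤ →+ localizedIntegers p :=
    (Int.castAddHom ℚ).codRestrict _ fun k => ⟨k, 1, isCoprime_one_left, by simp⟩
  have he (k : ℤ) : ((e k : localizedIntegers p) : ℚ) = k := rfl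
  refine nonempty_pAdicCompletion_equiv (Finsupp.mapRange.addMonoidHom e) (fun a b h => ?_)
    fun b => ?_
  · refine exists_smul_eq_of_forall_dvd fun i => dvd_of_smul_localizedIntegers_eq _ (b i) ?_
    rw [← he]
    exact congrArg Subtype.val (DFunLike.congr_fun h i)
  · induction b using Finsupp.induction_linear with
    | zero => exact ⟨0, 0, by simp⟩
    | add b b' h h' =>
      obtain ⟨a, c, rfl⟩ := h
      obtain ⟨a', c', rfl⟩ := h'
      exact ⟨a + a', c + c', by rw [map_add, smul_add]; abel⟩
    | single i q =>
      obtain ⟨k, r, h⟩ := exists_eq_intCast_add_smul q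
      refine ⟨Finsupp.single i k, Finsupp.single i r, ?_⟩
      rw [Finsupp.mapRange.addMonoidHom_apply, Finsupp.mapRange_single, Finsupp.smul_single,
        ← Finsupp.single_add]
      exact congrArg _ (Subtype.ext h)

/-- A lifted basis of `G/pG` gives a map from a free group that is an isomorphism modulo `p`. The
hypothesis on `f` serves only to show that the basis has size `lam`. -/
theorem nonempty_equiv_pAdicCompletion_int (p : Nat.Primes) (hlam : Cardinal.aleph0 ≤ lam)
    (hcard : Cardinal.mk G ≤ lam) (f : (lam.out →₀ ℤ) →+ G)
    (hf : ∀ (n : ℕ) g x, n • g = f x → ∃ x', n • x' = x) :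
    Nonempty (PAdicCompletion p (lam.out →₀ ℤ) ≃+ PAdicCompletion p G) := by
  have : Fact (p : ℕ).Prime := ⟨p.2⟩
  have hmk {x : G} : (Submodule.Quotient.mk x : ModN G p) = 0 ↔ ∃ y, ((p : ℕ) : ℤ) • y = x := by
    rw [Submodule.Quotient.mk_eq_zero]; rfl
  have hinj : Function.Injective fun i : lam.out =>
      (Submodule.Quotient.mk (f (Finsupp.single i 1)) : ModN G p) := by
    -- Distinct classes suffice, since an infinite vector space over a finite field has dimension
    -- equal to its cardinality. If two classes agreed, purity would make `e_i - e_j` divisible by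
    -- `p`, although it has a coordinate `1`.
    intro i j hij
    by_contra hne
    obtain ⟨y, hy⟩ := hmk.1 ((Submodule.Quotient.mk_sub _).trans (sub_eq_zero.2 hij))
    rw [← map_sub, natCast_zsmul] at hy
    obtain ⟨c, hc⟩ := hf _ _ _ hy
    have := DFunLike.congr_fun hc i
    simp [Finsupp.single_eq_of_ne hne] at this
    exact (Nat.prime_iff_prime_int.mp p.2).not_isUnit (IsUnit.of_mul_eq_one _ this)
  have hV : Cardinal.mk (ModN G p) = lam := by
    refine le_antisymm ?_ ?_
    · exact (Cardinal.mk_le_of_surjective (Submodule.Quotient.mk_surjective _)).trans hcard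
    · simpa using Cardinal.mk_le_of_injective hinj
  let b₀ := Module.Free.chooseBasis (ZMod p) (ModN G p)
  set ι := Module.Free.ChooseBasisIndex (ZMod p) (ModN G p)
  have hι : Cardinal.mk ι = lam := by
    have hV' : Cardinal.mk (ι →₀ ZMod p) = lam := by
      rw [← hV]; exact Cardinal.mk_congr b₀.repr.toEquiv.symm
    have : Infinite ι := by
      by_contra hfin
      rw [not_infinite_iff_finite] at hfin
      have hfin' : Finite (ι →₀ ZMod p) :=
        Finite.of_injective _ DFunLike.coe_injective
      exact absurd (Cardinal.lt_aleph0_of_finite (ι →₀ ZMod p)) (not_lt.2 (hV' ▸ hlam))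
    rw [Cardinal.mk_finsupp_lift_of_infinite] at hV'
    rw [← hV', Cardinal.lift_uzero, eq_comm, max_eq_left_iff]
    exact (Cardinal.lift_lt_aleph0.2 (Cardinal.lt_aleph0_of_finite (ZMod p))).le.trans
      (Cardinal.aleph0_le_mk ι)
  obtain ⟨e⟩ : Nonempty (ι ≃ lam.out) := Cardinal.eq.1 (by rw [hι, Cardinal.mk_out])
  let b := b₀.reindex e
  choose g hg using fun i => Submodule.Quotient.mk_surjective _ (b i)
  let φ : (lam.out →₀ ℤ) →+ G := (Finsupp.linearCombination ℤ g).toAddMonoidHom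
  -- Modulo `p`, `φ` is coordinatewise reduction followed by the basis isomorphism.
  have hφ (c : lam.out →₀ ℤ) : (Submodule.Quotient.mk (φ c) : ModN G p) =
      b.repr.symm (c.mapRange (Int.castRingHom (ZMod p)) (map_zero _)) := by
    have h : (ModN.mkQ p).comp φ = (b.repr.symm.toLinearMap.toAddMonoidHom).comp
        (Finsupp.mapRange.addMonoidHom (Int.castRingHom (ZMod p)).toAddMonoidHom) := by
      refine Finsupp.addHom_ext fun i k => ?_
      have h₁ : φ (Finsupp.single i k) = k • g i := Finsupp.linearCombination_single ..
      have h₂ : ModN.mkQ p (g i) = b i := hg i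
      rw [AddMonoidHom.comp_apply, h₁, map_zsmul, h₂]
      simpa using (Int.cast_smul_eq_zsmul (ZMod p) k (b i)).symm
    exact DFunLike.congr_fun h c
  refine nonempty_pAdicCompletion_equiv φ (fun a y h => ?_) fun y => ?_
  · refine exists_smul_eq_of_forall_dvd fun i => ?_
    have h0 := hmk.2 ⟨y, h⟩
    rw [hφ, LinearEquiv.map_eq_zero_iff] at h0
    exact (ZMod.intCast_zmod_eq_zero_iff_dvd _ _).1 (DFunLike.congr_fun h0 i)
  · let a : lam.out →₀ ℤ := (b.repr (Submodule.Quotient.mk y)).mapRange ZMod.cast ZMod.cast_zero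
    have ha : a.mapRange (Int.castRingHom (ZMod p)) (map_zero _) =
        b.repr (Submodule.Quotient.mk y) :=
      Finsupp.ext fun i => by simp [a]
    obtain ⟨z, hz⟩ := hmk.1 (show (Submodule.Quotient.mk (y - φ a) : ModN G p) = 0 by
      rw [Submodule.Quotient.mk_sub, hφ, ha, LinearEquiv.symm_apply_apply, sub_self])
    exact ⟨a, z, by rw [hz, add_sub_cancel]⟩

end Invariants

theorem mainTheorem4 (lam : Cardinal.{u}) (α : Ordinal.{u})
    (hα : Order.IsSuccLimit α) (hαlam : α < (Order.succ lam).ord)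
    (G : Type u) [AddCommGroup G]
    (hG : IsLimitModel lam α G) (hac : IsAlgebraicallyCompact G) :
    Nonempty (G ≃+
      ((lam.out →₀ ℚ) ×
        (∀ p : Nat.Primes, PAdicCompletion p (lam.out →₀ localizedIntegers p)))) := by
  have hlam := aleph0_le_of_isSuccLimit_lt hα hαlam
  have := hG.1.torsionFree
  have hcard := hG.1.card_eq.le
  have : Infinite lam.out := Cardinal.infinite_iff.2 (by simpa using hlam)
  -- The copy of `ℚ^(lam)` bounds the rank of the divisible part from below; the pure copy of
  -- `ℤ^(lam)` does the same for every `G/pG`.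
  obtain ⟨f, hf, -⟩ := hG.exists_pure_embedding hα hlam (X := lam.out →₀ ℚ) (by simp [hlam])
  obtain ⟨g, -, hg⟩ := hG.exists_pure_embedding hα hlam (X := lam.out →₀ ℤ) (by simp [hlam])
  obtain ⟨e⟩ := hac.nonempty_equiv
  obtain ⟨d⟩ := nonempty_divisiblePart_equiv hcard f hf
  let e₁ p := (nonempty_equiv_pAdicCompletion_int p hlam hcard g hg).some
  let e₂ p := (nonempty_pAdicCompletion_int_equiv p lam.out).some
  exact ⟨e.trans (d.prodCongr (AddEquiv.piCongrRight fun p => (e₁ p).symm.trans (e₂ p)))⟩
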